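/- Let $d\in\mathbb N$ and let $\mathcal X$ be a finite linearly independent set of Hermitian $d\times d$ complex matrices (the available observables) that contains the identity $I$ and satisfies $|\mathcal X|\ge d$. Consider a time-homogeneous Markovian evolution in the Heisenberg picture: a semigroup $(\Phi_t)_{t\in\mathcal T}$ of completely positive unital maps on $\mathbb C^{d\times d}$ with $\mathcal T=\mathbb N$ (discrete time) or $\mathcal T=\mathbb R_{\ge0}$ (continuous time). The system is *observable* if $\operatorname{span}_{\mathbb C}\{\Phi_t(X): X\in\mathcal X,\ t\in\mathcal T\}=\mathbb C^{d\times d}$. *Dynamical quantum state tomography (DQST) is feasible* if there are finitely many pairs $(X_1,t_1),\dots,(X_q,t_q)\in\mathcal X\times\mathcal T$ and a map $\mathrm{rec}$ such that every density matrix $\rho$ is recovered from the expectations, $\rho=\mathrm{rec}\big(\operatorname{tr}(\Phi_{t_1}(X_1)\rho),\dots,\operatorname{tr}(\Phi_{t_q}(X_q)\rho)\big)$. Then for a generic unitary evolution the system is observable and DQST is feasible; precisely: 1. (Discrete time.) For Haar-almost every $U\in\mathcal U(d)$, the system with $\Phi_t(X)=U^tX(U^t)^\dagger$, $t\in\mathbb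 N$, is observable and DQST is feasible. 2. (Continuous time, in terms of the propagator.) For Haar-almost every $U\in\mathcal U(d)$, for every Hermitian $H$ and every $\tau>0$ with $e^{i\tau H}=U$, the system with $\Phi_t(X)=e^{itH}Xe^{-itH}$, $t\ge0$ (the semigroup generated by $\mathcal L(X)=i[H,X]$), is observable and DQST is feasible. 3. (Continuous time, in terms of the Hamiltonian.) For almost every Hermitian $d\times d$ matrix $H$, with respect to Lebesgue measure on the real vector space of Hermitian matrices, the system with $\Phi_t(X)=e^{itH}Xe^{-itH}$, $t\ge0$, is observable and DQST is feasible. -/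

import Mathlib

open MeasureTheory
open scoped NNReal Matrix ComplexOrder

/-- A completely positive map on `d × d` complex matrices, through an operator-sum representation
`X ↦ ∑ₖ Mₖ X Mₖ†`. -/
def IsCompletelyPositive {d : ℕ}
    (Φ : Matrix (Fin d) (Fin d) ℂ →ₗ[ℂ] Matrix (Fin d) (Fin d) ℂ) : Prop :=
  ∃ (n : ℕ) (M : Fin n → Matrix (Fin d) (Fin d) ℂ), ∀ X, Φ X = ∑ k, M k * X * (M k)ᴴ

/-- A time-homogeneous Markovian evolution (Heisenberg picture) of the observables of a
`d`-dimensional quantum system, with times in `T` (`ℕ` or `ℝ≥0`): a semigroup of completely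
positive and unital maps. -/
structure MarkovEvolution (T : Type) [AddMonoid T] (d : ℕ) where
  Φ : T → (Matrix (Fin d) (Fin d) ℂ →ₗ[ℂ] Matrix (Fin d) (Fin d) ℂ)
  map_zero : Φ 0 = LinearMap.id
  map_add : ∀ t s, Φ (t + s) = Φ t ∘ₗ Φ s
  completelyPositive : ∀ t, IsCompletelyPositive (Φ t)
  unital : ∀ t, Φ t 1 = 1

/-- A set of available observables: a finite linearly independent set of Hermitian
matrices that contains the identity. -/
structure Observables (d : ℕ) where
  carrier : Finset (Matrix (Fin d) (Fin d) ℂ)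
  isHermitian : ∀ X ∈ carrier, X.IsHermitian
  one_mem : 1 ∈ carrier
  linearIndependent :
    LinearIndependent ℂ (fun X : carrier => (X : Matrix (Fin d) (Fin d) ℂ))

/-- Density matrices: the states of the system. -/
def IsDensity {d : ℕ} (ρ : Matrix (Fin d) (Fin d) ℂ) : Prop :=
  ρ.PosSemidef ∧ ρ.trace = 1

/-- The expectation `tr (X ρ)` of `X` in the state `ρ`. -/
def expectation {d : ℕ} (ρ X : Matrix (Fin d) (Fin d) ℂ) : ℂ :=
  (X * ρ).trace

namespace MarkovEvolution

variable {T : Type} [AddMonoid T] {d : ℕ}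

/-- The observable subspace: the span of all the evolved observables `Φ_t(X)`. -/
def observableSubspace (E : MarkovEvolution T d) (𝒳 : Observables d) :
    Submodule ℂ (Matrix (Fin d) (Fin d) ℂ) :=
  Submodule.span ℂ {Y | ∃ t : T, ∃ X ∈ 𝒳.carrier, Y = E.Φ t X}

/-- The system is observable: the observable subspace is the whole operator space. -/
def IsObservable (E : MarkovEvolution T d) (𝒳 : Observables d) : Prop :=
  E.observableSubspace 𝒳 = ⊤

/-- Dynamical quantum state tomography is feasible: for some finite choice `R` of measurements
(pairs of an available observable and a time), one reconstruction map recovers every initial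
state `ρ` from the expectations `tr (Φ_t(X) ρ)`, `(X, t) ∈ R`. -/
def DQSTFeasible (E : MarkovEvolution T d) (𝒳 : Observables d) : Prop :=
  ∃ (R : Finset (𝒳.carrier × T)) (reconstruct : (R → ℂ) → Matrix (Fin d) (Fin d) ℂ),
    ∀ ρ : Matrix (Fin d) (Fin d) ℂ, IsDensity ρ →
      reconstruct (fun r => expectation ρ (E.Φ r.1.2 (r.1.1 : Matrix (Fin d) (Fin d) ℂ))) = ρ

end MarkovEvolution

/-- Conjugation `X ↦ V X V†`. -/
def conjBy {d : ℕ} (V : Matrix (Fin d) (Fin d) ℂ) :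
    Matrix (Fin d) (Fin d) ℂ →ₗ[ℂ] Matrix (Fin d) (Fin d) ℂ where
  toFun X := V * X * Vᴴ
  map_add' X Y := by rw [mul_add, add_mul]
  map_smul' c X := by simp

/-- The discrete-time unitary evolution with `Φ₁(X) = U X U†`, so `Φ_t(X) = U^t X (U^t)†`. -/
def discreteUnitary {d : ℕ} (U : Matrix.unitaryGroup (Fin d) ℂ) : MarkovEvolution ℕ d where
  Φ t := conjBy ((U : Matrix (Fin d) (Fin d) ℂ) ^ t)
  map_zero := by ext X : 1; simp [conjBy]
  map_add t s := by
    ext X : 1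
    simp [conjBy, pow_add, Matrix.conjTranspose_mul, mul_assoc]
  completelyPositive t := ⟨1, fun _ => (U : Matrix (Fin d) (Fin d) ℂ) ^ t, by simp [conjBy]⟩
  unital t := by
    have h := (Matrix.mem_unitaryGroup_iff (A := ((U ^ t : Matrix.unitaryGroup (Fin d) ℂ) :
      Matrix (Fin d) (Fin d) ℂ))).1 (U ^ t).2
    simpa [conjBy, Matrix.star_eq_conjTranspose] using h

/-- The unitary propagator `exp (i t H)`. -/
noncomputable def propagator {d : ℕ} (H : Matrix (Fin d) (Fin d) ℂ) (t : ℝ) :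
    Matrix (Fin d) (Fin d) ℂ :=
  NormedSpace.exp ((Complex.I * (t : ℂ)) • H)

theorem propagator_zero {d : ℕ} (H : Matrix (Fin d) (Fin d) ℂ) : propagator H 0 = 1 := by
  simp [propagator]

theorem propagator_add {d : ℕ} (H : Matrix (Fin d) (Fin d) ℂ) (t s : ℝ) :
    propagator H (t + s) = propagator H t * propagator H s := by
  unfold propagator
  rw [← Matrix.exp_add_of_commute _ _ (((Commute.refl H).smul_left _).smul_right _), ← add_smul]
  push_cast
  rw [mul_add]

theorem propagator_conjTranspose {d : ℕ} {H : Matrix (Fin d) (Fin d) ℂ} (hH : H.IsHermitian)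
    (t : ℝ) : (propagator H t)ᴴ = propagator H (-t) := by
  unfold propagator
  rw [← Matrix.exp_conjTranspose, Matrix.conjTranspose_smul, hH.eq]
  simp

/-- `t ↦ exp (i t H) X exp (- i t H)` solves `Ẏ = i [H, Y]`. -/
theorem hasDerivAt_conjBy_propagator {d : ℕ} {H : Matrix (Fin d) (Fin d) ℂ}
    (hH : H.IsHermitian) (X : Matrix (Fin d) (Fin d) ℂ) (t : ℝ) :
    HasDerivAt (fun s : ℝ => conjBy (propagator H s) X)
      (Complex.I • (H * conjBy (propagator H t) X - conjBy (propagator H t) X * H)) t := by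
  let _ : NormedRing (Matrix (Fin d) (Fin d) ℂ) := Matrix.linftyOpNormedRing
  let _ : NormedAlgebra ℝ (Matrix (Fin d) (Fin d) ℂ) := Matrix.linftyOpNormedAlgebra
  have e : ∀ s, propagator H s = NormedSpace.exp (s • (Complex.I • H)) := by
    intro s
    simp [propagator, ← Complex.coe_smul, smul_smul, mul_comm]
  have e2 : ∀ s, (propagator H s)ᴴ = NormedSpace.exp (s • (-(Complex.I • H))) := by
    intro s
    rw [propagator_conjTranspose hH, e]
    simp
  have h1 := hasDerivAt_exp_smul_const' (𝕂 := ℝ) (Complex.I • H) t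
  have h2 := hasDerivAt_exp_smul_const (𝕂 := ℝ) (-(Complex.I • H)) t
  have h3 := (h1.mul_const X).mul h2
  simp only [conjBy, LinearMap.coe_mk, AddHom.coe_mk, e2]
  simp only [e]
  have e3 : ∀ A B : Matrix (Fin d) (Fin d) ℂ,
      Complex.I • (H * (A * X * B) - A * X * B * H) =
        Complex.I • H * A * X * B + A * X * (B * -(Complex.I • H)) := by
    intro A B
    simp [mul_assoc, smul_sub, sub_eq_add_neg]
  rw [e3]
  exact h3

/-- The continuous-time unitary evolution `Φ_t(X) = exp (i t H) X exp (- i t H)`, that is, the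
semigroup `exp (t ℒ)` with generator `ℒ(X) = i [H, X]`, for a Hermitian Hamiltonian `H`. -/
noncomputable def hamiltonianEvolution {d : ℕ}
    (H : selfAdjoint (Matrix (Fin d) (Fin d) ℂ)) : MarkovEvolution ℝ≥0 d where
  Φ t := conjBy (propagator (H : Matrix (Fin d) (Fin d) ℂ) (t : ℝ))
  map_zero := by ext X : 1; simp [conjBy, propagator_zero]
  map_add t s := by
    ext X : 1
    simp [conjBy, propagator_add, Matrix.conjTranspose_mul, mul_assoc]
  completelyPositive t :=
    ⟨1, fun _ => propagator (H : Matrix (Fin d) (Fin d) ℂ) (t : ℝ), by simp [conjBy]⟩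
  unital t := by
    have hH : (H : Matrix (Fin d) (Fin d) ℂ).IsHermitian := H.2
    simp only [conjBy, LinearMap.coe_mk, AddHom.coe_mk, mul_one]
    rw [propagator_conjTranspose hH, ← propagator_add, add_neg_cancel, propagator_zero]

/-- The Borel σ-algebra of the unitary group. -/
noncomputable instance unitaryGroupMeasurableSpace (d : ℕ) :
    MeasurableSpace (Matrix.unitaryGroup (Fin d) ℂ) := borel _

instance unitaryGroupBorelSpace (d : ℕ) : BorelSpace (Matrix.unitaryGroup (Fin d) ℂ) := ⟨rfl⟩

/-- The Borel σ-algebra of the real vector space of Hermitian matrices. -/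
noncomputable instance hermitianMeasurableSpace (d : ℕ) :
    MeasurableSpace (selfAdjoint (Matrix (Fin d) (Fin d) ℂ)) := borel _

instance hermitianBorelSpace (d : ℕ) : BorelSpace (selfAdjoint (Matrix (Fin d) (Fin d) ℂ)) := ⟨rfl⟩

/-! Fix `d²` pairs of an available observable and a discrete time. The evolved observables form a
basis exactly when the determinant `orbitDet` of their entries is nonzero, and this determinant is a
real-analytic function of the matrix `U`. A real-analytic function that is nonzero at one unitary is
nonzero almost everywhere, both at `exp (iH)` for Lebesgue measure (`ae_ne_zero_expUnitary`) and on
the unitary group for Haar measure (`ae_ne_zero_unitaryGroup`). So a single observable unitary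
settles the generic case; continuous time follows by sampling at multiples of `τ`, with `τ = 1` for
the Hamiltonian form.

To build that unitary, let `L` be the span of the observables, of dimension at least `d`. In a
suitable orthonormal basis `V` the diagonals of `L` fill `ℂ^d` and no off-diagonal entry vanishes
identically on `L`. Give `U` the eigenbasis `V` and eigenvalues with distinct quotients. Conjugation
by `U` then has the diagonal matrices as its eigenspace for `1` and a line for each off-diagonal
position. Spectral projections are polynomials in the conjugation, so they preserve the observable
subspace; applied to `L` they produce every matrix unit (`eq_top_of_conjBy_sidonUnitary_mem`).

The basis comes from an extremal argument, `exists_map_diagIn_eq_top`: if a basis with the largest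
space of diagonals fell short, rotating one coordinate plane would enlarge that space. Observability
gives tomography because the trace pairing is nondegenerate. -/

/-! ### Zero sets of real-analytic functions -/

theorem ae_ne_zero_of_analyticOnNhd_line {f : ℝ → ℂ} (hf : AnalyticOnNhd ℝ f Set.univ) {x : ℝ}
    (hx : f x ≠ 0) : ∀ᵐ s : ℝ, f s ≠ 0 := by
  have h := hf.preimage_zero_mem_codiscrete hx
  have h' := ae_restrict_le_codiscreteWithin (μ := volume) (MeasurableSet.univ (α := ℝ)) h
  rw [Measure.restrict_univ] at h'
  exact h'

/-- The zero set of a nonzero real-analytic function on a finite-dimensional real vector space is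
a null set. -/
theorem ae_ne_zero_of_analyticOnNhd {E : Type*} [NormedAddCommGroup E] [NormedSpace ℝ E]
    [FiniteDimensional ℝ E] [MeasurableSpace E] [BorelSpace E] (ν : Measure E)
    [ν.IsAddHaarMeasure] {f : E → ℂ} (hf : AnalyticOnNhd ℝ f Set.univ) {x₀ : E} (hx₀ : f x₀ ≠ 0) :
    ∀ᵐ x ∂ν, f x ≠ 0 := by
  have : ProperSpace E := FiniteDimensional.proper ℝ E
  have hc : Continuous f := by
    rw [← continuousOn_univ]
    exact hf.continuousOn
  have hg : Continuous fun p : E × ℝ => f (x₀ + p.2 • p.1) := by fun_prop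
  -- On every line through `x₀` the restriction is nonzero at `s = 0`. Fubini then yields one scale
  -- `s ≠ 0` that is good for almost every direction, and undoing the scaling and the translation
  -- preserves null sets.
  have h1 : ∀ᵐ y ∂ν, ∀ᵐ s : ℝ, f (x₀ + s • y) ≠ 0 := by
    refine Filter.Eventually.of_forall fun y => ?_
    refine ae_ne_zero_of_analyticOnNhd_line (f := fun s : ℝ => f (x₀ + s • y)) (x := 0) ?_
      (by simpa)
    intro s _
    exact (hf (x₀ + s • y) trivial).comp_of_eq (f := fun s : ℝ => x₀ + s • y)
      (by fun_prop) rfl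
  have h2 : ∀ᵐ s : ℝ, ∀ᵐ y ∂ν, f (x₀ + s • y) ≠ 0 := by
    refine (Measure.ae_ae_comm (p := fun y s => f (x₀ + s • y) ≠ 0) ?_).1 h1
    exact (isOpen_ne_fun hg continuous_const).measurableSet
  obtain ⟨s, hs, hs0⟩ := (h2.and (Measure.ae_ne volume (0 : ℝ))).exists
  have h3 : ν ((s • ·) ⁻¹' {x | f (x₀ + x) = 0}) = 0 := by
    simpa [ae_iff] using hs
  rw [Measure.addHaar_preimage_smul ν hs0] at h3
  have h4 : ν {x | f (x₀ + x) = 0} = 0 := by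
    rcases mul_eq_zero.1 h3 with h | h
    · exfalso
      rw [ENNReal.ofReal_eq_zero] at h
      have : 0 < |(s ^ Module.finrank ℝ E)⁻¹| := by positivity
      linarith
    · exact h
  have h5 : ν ((x₀ + ·) ⁻¹' {x | f x = 0}) = 0 := h4
  rw [measure_preimage_add] at h5
  simpa [ae_iff] using h5

/-! ### Generic unitaries through the exponential -/

section Unitary
open scoped Matrix.Norms.L2Operator

instance finiteDimensional_selfAdjoint_matrix (d : ℕ) :
    FiniteDimensional ℝ (selfAdjoint (Matrix (Fin d) (Fin d) ℂ)) :=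
  FiniteDimensional.of_injective (selfAdjoint.submodule ℝ (Matrix (Fin d) (Fin d) ℂ)).subtype
    Subtype.val_injective

theorem isClosed_unitaryGroup (d : ℕ) :
    IsClosed (Matrix.unitaryGroup (Fin d) ℂ : Set (Matrix (Fin d) (Fin d) ℂ)) := by
  have : (Matrix.unitaryGroup (Fin d) ℂ : Set (Matrix (Fin d) (Fin d) ℂ)) =
      {A | A * star A = 1} := by
    ext A
    exact Matrix.mem_unitaryGroup_iff
  rw [this]
  exact isClosed_eq (by fun_prop) continuous_const

theorem expUnitary_argSelfAdjoint_of_continuousOn {A : Type*} [CStarAlgebra A] {u : unitary A}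
    (hu : ContinuousOn Complex.arg (spectrum ℂ (u : A))) :
    selfAdjoint.expUnitary (Unitary.argSelfAdjoint u) = u := by
  ext1
  rw [selfAdjoint.expUnitary_coe, Unitary.argSelfAdjoint_coe,
    ← CFC.exp_eq_normedSpace_exp (𝕜 := ℂ), ← cfc_comp_smul .., ← cfc_comp' ..]
  conv_rhs => rw [← cfc_id' ℂ (u : A)]
  refine cfc_congr fun y hy ↦ ?_
  have hy₁ : ‖y‖ = 1 := spectrum.norm_eq_one_of_unitary u.2 hy
  have : Complex.I * y.arg = Complex.log y :=
    Complex.ext (by simp [Complex.log_re, hy₁]) (by simp [Complex.log_im])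
  simpa [← Complex.exp_eq_exp_ℂ, this] using Complex.exp_log (by rintro rfl; simp at hy₁)

/-- The spectrum of a matrix is finite, so `arg` is continuous on it even if it meets the branch
cut. -/
theorem exists_expUnitary_eq {d : ℕ} (u : Matrix.unitaryGroup (Fin d) ℂ) :
    ∃ H : selfAdjoint (Matrix (Fin d) (Fin d) ℂ), selfAdjoint.expUnitary H = u :=
  ⟨Unitary.argSelfAdjoint u, expUnitary_argSelfAdjoint_of_continuousOn
    ((Matrix.finite_spectrum _).continuousOn _)⟩

theorem analyticOnNhd_expUnitary_mul {d : ℕ} {F : Matrix (Fin d) (Fin d) ℂ → ℂ}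
    (hF : AnalyticOnNhd ℝ F Set.univ) (U : Matrix (Fin d) (Fin d) ℂ) :
    AnalyticOnNhd ℝ (fun H : selfAdjoint (Matrix (Fin d) (Fin d) ℂ) =>
      F ((selfAdjoint.expUnitary H : Matrix (Fin d) (Fin d) ℂ) * U)) Set.univ := by
  intro H _
  refine (hF _ trivial).comp_of_eq (f := fun H : selfAdjoint (Matrix (Fin d) (Fin d) ℂ) =>
    (selfAdjoint.expUnitary H : Matrix (Fin d) (Fin d) ℂ) * U) (AnalyticAt.mul ?_ analyticAt_const)
    rfl
  simp only [selfAdjoint.expUnitary_coe]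
  refine (NormedSpace.exp_analytic (𝕂 := ℝ) _).comp_of_eq (f :=
    fun H : selfAdjoint (Matrix (Fin d) (Fin d) ℂ) => Complex.I • (H : Matrix (Fin d) (Fin d) ℂ))
    ?_ rfl
  exact (LinearMap.toContinuousLinearMap ((LinearMap.lsmul ℂ (Matrix (Fin d) (Fin d) ℂ)
    Complex.I).restrictScalars ℝ ∘ₗ
    (selfAdjoint.submodule ℝ (Matrix (Fin d) (Fin d) ℂ)).subtype)).analyticAt H

/-- A real-analytic function of a matrix that does not vanish at some unitary does not vanish at
`exp (i H)` for almost every Hermitian `H`. -/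
theorem ae_ne_zero_expUnitary {d : ℕ} {F : Matrix (Fin d) (Fin d) ℂ → ℂ}
    (hF : AnalyticOnNhd ℝ F Set.univ) {U₀ : Matrix.unitaryGroup (Fin d) ℂ} (h₀ : F U₀ ≠ 0)
    (ν : Measure (selfAdjoint (Matrix (Fin d) (Fin d) ℂ))) [ν.IsAddHaarMeasure]
    (U : Matrix.unitaryGroup (Fin d) ℂ) :
    ∀ᵐ H ∂ν, F (selfAdjoint.expUnitary H * U : Matrix.unitaryGroup (Fin d) ℂ) ≠ 0 := by
  obtain ⟨H₀, hH₀⟩ := exists_expUnitary_eq (U₀ * U⁻¹)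
  refine ae_ne_zero_of_analyticOnNhd ν (x₀ := H₀) (analyticOnNhd_expUnitary_mul hF U) ?_
  have : (selfAdjoint.expUnitary H₀ * U : Matrix.unitaryGroup (Fin d) ℂ) = U₀ := by
    rw [hH₀, inv_mul_cancel_right]
  simpa [← this] using h₀

/-- A real-analytic function of a matrix that does not vanish at some unitary does not vanish at
Haar-almost every unitary. -/
theorem ae_ne_zero_unitaryGroup {d : ℕ} {F : Matrix (Fin d) (Fin d) ℂ → ℂ}
    (hF : AnalyticOnNhd ℝ F Set.univ) {U₀ : Matrix.unitaryGroup (Fin d) ℂ} (h₀ : F U₀ ≠ 0)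
    (μ : Measure (Matrix.unitaryGroup (Fin d) ℂ)) [μ.IsHaarMeasure]
    (ν : Measure (selfAdjoint (Matrix (Fin d) (Fin d) ℂ))) [ν.IsAddHaarMeasure] :
    ∀ᵐ U : Matrix.unitaryGroup (Fin d) ℂ ∂μ, F U ≠ 0 := by
  have : SigmaCompactSpace (Matrix (Fin d) (Fin d) ℂ) :=
    have := FiniteDimensional.proper ℂ (Matrix (Fin d) (Fin d) ℂ)
    inferInstance
  have : SigmaCompactSpace (Matrix.unitaryGroup (Fin d) ℂ) :=
    (isClosed_unitaryGroup d).isClosedEmbedding_subtypeVal.sigmaCompactSpace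
  have : ProperSpace (selfAdjoint (Matrix (Fin d) (Fin d) ℂ)) := FiniteDimensional.proper ℝ _
  have hc : Continuous F := by
    rw [← continuousOn_univ]
    exact hF.continuousOn
  have he := selfAdjoint.continuous_expUnitary (A := Matrix (Fin d) (Fin d) ℂ)
  have h1 : ∀ᵐ U ∂μ, ∀ᵐ H ∂ν,
      F (selfAdjoint.expUnitary H * U : Matrix.unitaryGroup (Fin d) ℂ) ≠ 0 :=
    Filter.Eventually.of_forall fun U => ae_ne_zero_expUnitary hF h₀ ν U
  have hg : Continuous fun p : Matrix.unitaryGroup (Fin d) ℂ ×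
      selfAdjoint (Matrix (Fin d) (Fin d) ℂ) =>
      F (selfAdjoint.expUnitary p.2 * p.1 : Matrix.unitaryGroup (Fin d) ℂ) :=
    hc.comp (continuous_subtype_val.comp ((he.comp continuous_snd).mul continuous_fst))
  have h2 : ∀ᵐ H ∂ν, ∀ᵐ U ∂μ,
      F (selfAdjoint.expUnitary H * U : Matrix.unitaryGroup (Fin d) ℂ) ≠ 0 := by
    refine (Measure.ae_ae_comm (p := fun (U : Matrix.unitaryGroup (Fin d) ℂ) H =>
      F (selfAdjoint.expUnitary H * U : Matrix.unitaryGroup (Fin d) ℂ) ≠ 0) ?_).1 h1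
    exact (isOpen_ne_fun hg continuous_const).measurableSet
  -- One `H` that is good for almost every `U` suffices, since left translation by `exp (iH)`
  -- preserves `μ`.
  obtain ⟨H, hH⟩ := h2.exists
  have h3 : μ ((selfAdjoint.expUnitary H * ·) ⁻¹' {U : Matrix.unitaryGroup (Fin d) ℂ | F U = 0}) = 0 := by
    simpa [ae_iff] using hH
  rw [measure_preimage_mul] at h3
  simpa [ae_iff] using h3
end Unitary

/-! ### Diagonals under plane rotations -/

section Diagonals
variable {n : Type*} [Fintype n] [DecidableEq n]

/-- The unitary that rotates the coordinate plane spanned by `i` and `j`, with phase `ω`. -/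
noncomputable def planeRotation (i j : n) (ω : ℂ) : Matrix n n ℂ :=
  -- The Pythagorean pair `3/5`, `4/5` keeps the arithmetic rational; all that matters is that sine
  -- and cosine are both nonzero.
  (Matrix.of fun a => if a = i then (3 / 5 : ℂ) • Pi.single i 1 + (4 / 5 * ω) • Pi.single j 1
    else if a = j then (-(4 / 5) * star ω) • Pi.single i 1 + (3 / 5 : ℂ) • Pi.single j 1
    else Pi.single a 1)ᵀ

theorem mul_planeRotation_apply (i j : n) (ω : ℂ) (X : Matrix n n ℂ) (a b : n) :
    (X * planeRotation i j ω) a b =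
      if b = i then 3 / 5 * X a i + 4 / 5 * ω * X a j
      else if b = j then -(4 / 5) * star ω * X a i + 3 / 5 * X a j
      else X a b := by
  simp only [Matrix.mul_apply, planeRotation, Matrix.transpose_apply, Matrix.of_apply]
  split_ifs <;> simp [mul_add, Finset.sum_add_distrib, Pi.single_apply] <;> ring

theorem planeRotation_conjTranspose_mul_apply (i j : n) (ω : ℂ) (X : Matrix n n ℂ) (a b : n) :
    ((planeRotation i j ω)ᴴ * X) a b =
      if a = i then 3 / 5 * X i b + 4 / 5 * star ω * X j b
      else if a = j then -(4 / 5) * ω * X i b + 3 / 5 * X j b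
      else X a b := by
  have h : ((planeRotation i j ω)ᴴ * X) = (Xᴴ * planeRotation i j ω)ᴴ := by
    simp [Matrix.conjTranspose_mul]
  rw [h, Matrix.conjTranspose_apply, mul_planeRotation_apply]
  split_ifs <;> simp

theorem planeRotation_mem_unitaryGroup {i j : n} (hij : i ≠ j) {ω : ℂ} (hω : star ω * ω = 1) :
    planeRotation i j ω ∈ Matrix.unitaryGroup n ℂ := by
  rw [Matrix.mem_unitaryGroup_iff', Matrix.star_eq_conjTranspose]
  have h : (planeRotation i j ω)ᴴ * planeRotation i j ω =
      (planeRotation i j ω)ᴴ * (1 * planeRotation i j ω) := by rw [one_mul]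
  rw [h]
  ext a b
  rw [planeRotation_conjTranspose_mul_apply]
  simp only [mul_planeRotation_apply, Matrix.one_apply]
  split_ifs <;> subst_vars <;> first | contradiction | skip
  all_goals first | ring1 | skip
  all_goals simp_all
  all_goals linear_combination (16 / 25) * hω

/-- The diagonal of `V† X V` as a linear function of `X`. -/
noncomputable def diagIn (V : Matrix n n ℂ) : Matrix n n ℂ →ₗ[ℂ] (n → ℂ) where
  toFun X := (Vᴴ * X * V).diag
  map_add' X Y := by simp [mul_add, add_mul]
  map_smul' c X := by simp

theorem diagIn_apply (V X : Matrix n n ℂ) (i : n) : diagIn V X i = (Vᴴ * X * V) i i := rfl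

theorem diagIn_mul (V R X : Matrix n n ℂ) : diagIn (V * R) X = diagIn R (Vᴴ * X * V) := by
  ext i
  simp [diagIn_apply, Matrix.conjTranspose_mul, mul_assoc]

/-- The difference of two standard basis vectors. -/
def singleSub (i j : n) : n → ℂ := Pi.single i 1 - Pi.single j 1

/-- A plane rotation preserves the trace of its `2 × 2` block and leaves the other diagonal entries
alone, so the diagonal can only move along `singleSub i j`. -/
theorem diagIn_planeRotation {i j : n} (hij : i ≠ j) {ω : ℂ} (hω : star ω * ω = 1)
    (X : Matrix n n ℂ) :
    diagIn (planeRotation i j ω) X = X.diag + (16 / 25 * (X j j - X i i) +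
      12 / 25 * (ω * X i j + star ω * X j i)) • singleSub i j := by
  ext k
  simp only [diagIn_apply, mul_planeRotation_apply, planeRotation_conjTranspose_mul_apply,
    singleSub, Pi.add_apply, Pi.smul_apply, Pi.sub_apply, Pi.single_apply, Matrix.diag_apply]
  split_ifs <;> subst_vars <;> first | contradiction | skip
  · simp only [smul_eq_mul]
    linear_combination (16 / 25 * X j j) * hω
  · simp only [smul_eq_mul]
    linear_combination (16 / 25 * X i i) * hω
  · simp

theorem map_sup_eq_of_sub_mem {M N : Type*} [AddCommGroup M] [Module ℂ M] [AddCommGroup N]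
    [Module ℂ N] (f g : M →ₗ[ℂ] N) (L : Submodule ℂ M) (S : Submodule ℂ N)
    (h : ∀ X ∈ L, f X - g X ∈ S) : L.map f ⊔ S = L.map g ⊔ S := by
  have key : ∀ f g : M →ₗ[ℂ] N, (∀ X ∈ L, f X - g X ∈ S) → L.map f ⊔ S ≤ L.map g ⊔ S := by
    intro f g h
    refine sup_le ?_ le_sup_right
    rintro _ ⟨X, hX, rfl⟩
    rw [← sub_add_cancel (f X) (g X)]
    exact add_mem (Submodule.mem_sup_right (h X hX))
      (Submodule.mem_sup_left (Submodule.mem_map_of_mem hX))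
  refine le_antisymm (key f g h) (key g f fun X hX => ?_)
  rw [← neg_sub]
  exact neg_mem (h X hX)

end Diagonals

/-! ### A basis in which the diagonals fill the space -/

section Diagonals
variable {n : Type*} [Fintype n] [DecidableEq n]

theorem map_diagIn_mul_planeRotation_sup (L : Submodule ℂ (Matrix n n ℂ)) (V : Matrix n n ℂ)
    {i j : n} (hij : i ≠ j) {ω : ℂ} (hω : star ω * ω = 1) :
    L.map (diagIn (V * planeRotation i j ω)) ⊔ ℂ ∙ singleSub i j =
      L.map (diagIn V) ⊔ ℂ ∙ singleSub i j := by
  refine map_sup_eq_of_sub_mem _ _ _ _ fun X _ => ?_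
  rw [diagIn_mul, diagIn_planeRotation hij hω]
  change (Vᴴ * X * V).diag + _ - (Vᴴ * X * V).diag ∈ _
  rw [add_sub_cancel_left]
  exact Submodule.smul_mem _ _ (Submodule.mem_span_singleton_self _)

/-- `V` maximizes the dimension of the space of diagonals of `V† X V`, `X ∈ L`. -/
def IsDiagMaximal (L : Submodule ℂ (Matrix n n ℂ)) (V : Matrix n n ℂ) : Prop :=
  V ∈ Matrix.unitaryGroup n ℂ ∧ ∀ V' ∈ Matrix.unitaryGroup n ℂ,
    Module.finrank ℂ (L.map (diagIn V')) ≤ Module.finrank ℂ (L.map (diagIn V))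

theorem exists_isDiagMaximal (L : Submodule ℂ (Matrix n n ℂ)) : ∃ V, IsDiagMaximal L V := by
  let S : Set ℕ := {k | ∃ V ∈ Matrix.unitaryGroup n ℂ, Module.finrank ℂ (L.map (diagIn V)) = k}
  have hb : BddAbove S := ⟨Module.finrank ℂ (n → ℂ), by
    rintro _ ⟨V, _, rfl⟩
    exact Submodule.finrank_le _⟩
  obtain ⟨V, hV, h⟩ := Nat.sSup_mem (s := S) ⟨_, 1, one_mem _, rfl⟩ hb
  refine ⟨V, hV, fun V' hV' => ?_⟩
  rw [h]
  exact le_csSup hb ⟨V', hV', rfl⟩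

/-- Rotating the `i, j` plane with a suitable phase turns the zero diagonal of `Z` into a nonzero
multiple of `singleSub i j`. The two spaces of diagonals agree modulo this vector, so if it were
missing before, the dimension would grow beyond the maximum. -/
theorem IsDiagMaximal.singleSub_mem {L : Submodule ℂ (Matrix n n ℂ)} {V : Matrix n n ℂ}
    (hV : IsDiagMaximal L V) {Z : Matrix n n ℂ} (hZ : Z ∈ L) (hd : diagIn V Z = 0) {i j : n}
    (hij : i ≠ j) (h : (Vᴴ * Z * V) i j ≠ 0) : singleSub i j ∈ L.map (diagIn V) := by
  by_contra hmem
  obtain ⟨ω, hω, hne⟩ : ∃ ω : ℂ, star ω * ω = 1 ∧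
      ω * (Vᴴ * Z * V) i j + star ω * (Vᴴ * Z * V) j i ≠ 0 := by
    -- The phases `1` and `I` suffice: if both expressions vanish, so do the sum and the difference
    -- of the two entries.
    by_contra! hcon
    have h1 := hcon 1 (by simp)
    have h2 := hcon Complex.I (by simp)
    simp only [star_one, one_mul, Complex.star_def, Complex.conj_I] at h1 h2
    apply h
    linear_combination (1 / 2) * h1 - (1 / 2) * Complex.I * h2 +
      (1 / 2) * ((Vᴴ * Z * V) i j - (Vᴴ * Z * V) j i) * Complex.I_sq
  have hR := planeRotation_mem_unitaryGroup hij hω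
  have hs := map_diagIn_mul_planeRotation_sup L V hij hω
  have hmem' : singleSub i j ∈ L.map (diagIn (V * planeRotation i j ω)) := by
    have hd' : (Vᴴ * Z * V).diag = 0 := hd
    have e : diagIn (V * planeRotation i j ω) Z = (12 / 25 *
        (ω * (Vᴴ * Z * V) i j + star ω * (Vᴴ * Z * V) j i)) • singleSub i j := by
      have hi : (Vᴴ * Z * V) i i = 0 := congrFun hd' i
      have hj : (Vᴴ * Z * V) j j = 0 := congrFun hd' j
      rw [diagIn_mul, diagIn_planeRotation hij hω, hd', hi, hj]
      simp
    refine (Submodule.smul_mem_iff _ (mul_ne_zero (by norm_num : (12 / 25 : ℂ) ≠ 0) hne)).1 ?_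
    rw [← e]
    exact Submodule.mem_map_of_mem hZ
  rw [sup_eq_left.2 (by simpa using hmem')] at hs
  have hle := hV.2 _ (mul_mem hV.1 hR)
  rw [hs, Submodule.finrank_sup_span_singleton hmem] at hle
  omega

theorem eq_top_of_singleSub_mem {W : Submodule ℂ (n → ℂ)} (h1 : 1 ∈ W) (i : n)
    (h : ∀ j, singleSub i j ∈ W) : W = ⊤ := by
  have hi : (Pi.single i 1 : n → ℂ) ∈ W := by
    have h2 : (1 : n → ℂ) + ∑ j, singleSub i j = (Fintype.card n : ℂ) • Pi.single i 1 := by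
      simp only [singleSub, Finset.sum_sub_distrib, Finset.sum_const, Finset.card_univ]
      have : ∑ j, (Pi.single j 1 : n → ℂ) = 1 := by
        ext k
        simp [Pi.single_apply]
      rw [this, Nat.cast_smul_eq_nsmul]
      abel
    have hcard : (Fintype.card n : ℂ) ≠ 0 := by
      have : Nonempty n := ⟨i⟩
      exact_mod_cast Fintype.card_ne_zero
    refine (Submodule.smul_mem_iff _ hcard).1 ?_
    rw [← h2]
    exact add_mem h1 (sum_mem fun j _ => h j)
  have hj : ∀ j, (Pi.single j 1 : n → ℂ) ∈ W := fun j => by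
    have := sub_mem hi (h j)
    simpa [singleSub] using this
  rw [eq_top_iff]
  intro x _
  rw [pi_eq_sum_univ' x]
  exact sum_mem fun j _ => Submodule.smul_mem _ _ (hj j)

/-- A space of matrices that contains the identity and whose dimension is at least the size of the
matrices has, in some orthonormal basis, all vectors as diagonals. -/
theorem exists_map_diagIn_eq_top {L : Submodule ℂ (Matrix n n ℂ)} (h1 : 1 ∈ L)
    (hL : Fintype.card n ≤ Module.finrank ℂ L) :
    ∃ V ∈ Matrix.unitaryGroup n ℂ, L.map (diagIn V) = ⊤ := by
  obtain ⟨V, hV⟩ := exists_isDiagMaximal L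
  refine ⟨V, hV.1, ?_⟩
  by_contra hW
  have hVV : Vᴴ * V = 1 := Matrix.mem_unitaryGroup_iff'.1 hV.1
  have hVV' : V * Vᴴ = 1 := Matrix.mem_unitaryGroup_iff.1 hV.1
  have hone : (1 : n → ℂ) ∈ L.map (diagIn V) := by
    refine ⟨1, h1, ?_⟩
    ext k
    simp [diagIn_apply, hVV]
  obtain ⟨Z, hZ, hd, hZ0⟩ : ∃ Z ∈ L, diagIn V Z = 0 ∧ Z ≠ 0 := by
    -- If the diagonal map were injective on `L`, its image would have dimension at least `card n`
    -- and be everything.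
    by_contra! hcon
    have hinj : Function.Injective ((diagIn V).domRestrict L) := by
      rw [← LinearMap.ker_eq_bot, LinearMap.ker_eq_bot']
      intro Z hZ
      exact Subtype.ext (hcon Z Z.2 hZ)
    have hfr := LinearMap.finrank_range_of_inj hinj
    rw [LinearMap.range_domRestrict] at hfr
    refine hW (Submodule.eq_top_of_finrank_eq (le_antisymm (Submodule.finrank_le _) ?_))
    rw [hfr]
    simpa using hL
  set Y := Vᴴ * Z * V with hY
  have hdY : ∀ k, Y k k = 0 := fun k => congrFun hd k
  obtain ⟨l, i, hli⟩ : ∃ l i, Y l i ≠ 0 := by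
    by_contra! hcon
    apply hZ0
    have : Y = 0 := by
      ext a b
      exact hcon a b
    calc Z = V * Y * Vᴴ := by
          rw [hY]
          simp only [← mul_assoc, hVV', one_mul]
          simp only [mul_assoc, hVV', mul_one]
      _ = 0 := by simp [this]
  have hne : l ≠ i := by
    rintro rfl
    exact hli (hdY l)
  have mem_li := hV.singleSub_mem hZ hd hne hli
  obtain ⟨j, hj⟩ : ∃ j, singleSub i j ∉ L.map (diagIn V) := by
    by_contra! hcon
    exact hW (eq_top_of_singleSub_mem hone i hcon)
  have hij : i ≠ j := by
    rintro rfl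
    simp [singleSub] at hj
  have hlj : l ≠ j := by
    rintro rfl
    apply hj
    rw [singleSub, ← neg_sub]
    exact neg_mem mem_li
  have hmem_lj : singleSub l j ∉ L.map (diagIn V) := fun hmem => hj <| by
    have := sub_mem hmem mem_li
    simpa [singleSub] using this
  have Yij : Y i j = 0 := by
    by_contra hcon
    exact hj (hV.singleSub_mem hZ hd hij hcon)
  have Yji : Y j i = 0 := by
    by_contra hcon
    apply hj
    rw [singleSub, ← neg_sub]
    exact neg_mem (hV.singleSub_mem hZ hd hij.symm hcon)
  have Ylj : Y l j = 0 := by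
    by_contra hcon
    exact hmem_lj (hV.singleSub_mem hZ hd hlj hcon)
  have h11 : star (1 : ℂ) * 1 = 1 := by simp
  have hR := planeRotation_mem_unitaryGroup hij h11
  have hs := map_diagIn_mul_planeRotation_sup L V hij h11
  -- Since the entries `i j`, `j i` and `l j` of `Y` vanish, this rotation keeps the diagonal zero
  -- and spreads the entry `l i` over both positions `l i` and `l j`. Maximality of `V'` then yields
  -- both differences, hence the missing `singleSub i j`.
  set V' := V * planeRotation i j 1 with hV'
  have hY' : V'ᴴ * Z * V' = (planeRotation i j 1)ᴴ * Y * planeRotation i j 1 := by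
    simp [hV', hY, Matrix.conjTranspose_mul, mul_assoc]
  have hmax : IsDiagMaximal L V' := by
    refine ⟨mul_mem hV.1 hR, fun V'' hV'' => (hV.2 V'' hV'').trans ?_⟩
    -- Adding the missing direction to the rotated diagonals gives the maximum plus one, and one
    -- vector adds at most one dimension; so the rotated diagonals already attain the maximum.
    have h2 : Module.finrank ℂ (L.map (diagIn V)) + 1 =
        Module.finrank ℂ ↥(L.map (diagIn V') ⊔ ℂ ∙ singleSub i j) := by
      rw [hs, Submodule.finrank_sup_span_singleton hj]
    by_cases hmem : singleSub i j ∈ L.map (diagIn V')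
    · rw [sup_eq_left.2 (by simpa using hmem)] at h2
      omega
    · rw [Submodule.finrank_sup_span_singleton hmem] at h2
      omega
  have hd' : diagIn V' Z = 0 := by
    rw [hV', diagIn_mul, diagIn_planeRotation hij h11, ← hY, hdY i, hdY j, Yij, Yji]
    ext k
    simpa using hdY k
  have e1 : (V'ᴴ * Z * V') l i ≠ 0 := by
    rw [hY', mul_planeRotation_apply, if_pos rfl]
    simp only [planeRotation_conjTranspose_mul_apply, if_neg hne, if_neg hlj, Ylj]
    simpa using hli
  have e2 : (V'ᴴ * Z * V') l j ≠ 0 := by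
    rw [hY', mul_planeRotation_apply, if_neg hij.symm, if_pos rfl]
    simp only [planeRotation_conjTranspose_mul_apply, if_neg hne, if_neg hlj, Ylj]
    simpa using hli
  have m1 := hmax.singleSub_mem hZ hd' hne e1
  have m2 := hmax.singleSub_mem hZ hd' hlj e2
  have m3 : singleSub i j ∈ L.map (diagIn V') := by
    have := sub_mem m2 m1
    simpa [singleSub] using this
  rw [sup_eq_left.2 (by simpa using m3)] at hs
  have hle := hV.2 _ hmax.1
  rw [hs, Submodule.finrank_sup_span_singleton hj] at hle
  omega

end Diagonals

/-! ### Making an off-diagonal entry nonzero -/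

section OffDiagonal
variable {n : Type*} [Fintype n] [DecidableEq n]

theorem one_submatrix_mem_unitaryGroup (σ : Equiv.Perm n) :
    (1 : Matrix n n ℂ).submatrix id σ ∈ Matrix.unitaryGroup n ℂ := by
  rw [Matrix.mem_unitaryGroup_iff']
  ext a b
  simp [Matrix.mul_apply, Matrix.one_apply, eq_comm]

theorem conj_one_submatrix_apply (σ : Equiv.Perm n) (X : Matrix n n ℂ) (a b : n) :
    (((1 : Matrix n n ℂ).submatrix id σ)ᴴ * X * (1 : Matrix n n ℂ).submatrix id σ) a b =
      X (σ a) (σ b) := by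
  simp [Matrix.mul_apply, Matrix.one_apply]

omit [Fintype n] in
theorem exists_perm_apply_eq {i j k l : n} (hij : i ≠ j) (hkl : k ≠ l) :
    ∃ σ : Equiv.Perm n, σ i = k ∧ σ j = l := by
  have h : Equiv.swap i k j ≠ k := fun h => hij (by simpa using congrArg (Equiv.swap i k) h.symm)
  exact ⟨Equiv.swap (Equiv.swap i k j) l * Equiv.swap i k, by
    simp [Equiv.swap_apply_of_ne_of_ne h.symm hkl], by simp⟩

/-- A nonzero off-diagonal entry can be permuted into place. A diagonal non-scalar matrix has two
unequal diagonal entries, and rotating their plane puts a multiple of their difference off the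
diagonal. -/
theorem exists_conj_apply_ne_zero {X : Matrix n n ℂ} (hX : X ∉ ℂ ∙ (1 : Matrix n n ℂ)) {i j : n}
    (hij : i ≠ j) : ∃ V ∈ Matrix.unitaryGroup n ℂ, (Vᴴ * X * V) i j ≠ 0 := by
  by_cases h : ∃ k l, k ≠ l ∧ X k l ≠ 0
  · obtain ⟨k, l, hkl, hne⟩ := h
    obtain ⟨σ, rfl, rfl⟩ := exists_perm_apply_eq hij hkl
    exact ⟨_, one_submatrix_mem_unitaryGroup σ, by rwa [conj_one_submatrix_apply]⟩
  · push Not at h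
    obtain ⟨k, hk⟩ : ∃ k, X k k ≠ X i i := by
      by_contra! hcon
      refine hX (Submodule.mem_span_singleton.2 ⟨X i i, ?_⟩)
      ext a b
      by_cases hab : a = b
      · subst hab
        simp [hcon a]
      · simp [hab, h a b hab]
    have hki : i ≠ k := by
      rintro rfl
      exact hk rfl
    obtain ⟨σ, hσi, hσj⟩ := exists_perm_apply_eq hij hki
    refine ⟨_, mul_mem (one_submatrix_mem_unitaryGroup σ)
      (planeRotation_mem_unitaryGroup hij (ω := 1) (by simp)), ?_⟩
    set P := (1 : Matrix n n ℂ).submatrix id σ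
    have e : (P * planeRotation i j 1)ᴴ * X * (P * planeRotation i j 1) =
        (planeRotation i j 1)ᴴ * ((Pᴴ * X * P) * planeRotation i j 1) := by
      simp [Matrix.conjTranspose_mul, mul_assoc]
    have e2 : ((P * planeRotation i j 1)ᴴ * X * (P * planeRotation i j 1)) i j =
        12 / 25 * (X k k - X i i) := by
      rw [e, planeRotation_conjTranspose_mul_apply, if_pos rfl, mul_planeRotation_apply,
        mul_planeRotation_apply, if_neg hij.symm, if_pos rfl]
      simp only [P, conj_one_submatrix_apply, hσi, hσj, h i k hki, h k i hki.symm]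
      simp only [star_one, if_neg hij.symm, if_true]
      ring
    rw [e2]
    exact mul_ne_zero (by norm_num) (sub_ne_zero.2 hk)

end OffDiagonal

/-! ### Both conditions on the basis at once, by genericity -/

section Analytic
open scoped Matrix.Norms.L2Operator
variable {d : ℕ}

theorem AnalyticAt.matrix_apply {E : Type*} [NormedAddCommGroup E] [NormedSpace ℝ E]
    {G : E → Matrix (Fin d) (Fin d) ℂ} {x : E} (hG : AnalyticAt ℝ G x) (i j : Fin d) :
    AnalyticAt ℝ (fun y => G y i j) x :=
  ((LinearMap.toContinuousLinearMap
    ((Matrix.entryLinearMap ℂ ℂ i j).restrictScalars ℝ)).analyticAt _).comp hG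

theorem AnalyticAt.matrix_conjTranspose {E : Type*} [NormedAddCommGroup E] [NormedSpace ℝ E]
    {G : E → Matrix (Fin d) (Fin d) ℂ} {x : E} (hG : AnalyticAt ℝ G x) :
    AnalyticAt ℝ (fun y => (G y)ᴴ) x :=
  ((LinearMap.toContinuousLinearMap
    (Matrix.conjTransposeLinearEquiv (Fin d) (Fin d) ℝ ℂ).toLinearMap).analyticAt _).comp hG

theorem AnalyticAt.matrix_det {E : Type*} [NormedAddCommGroup E] [NormedSpace ℝ E] {m : Type*}
    [Fintype m] [DecidableEq m] {G : E → Matrix m m ℂ} {x : E}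
    (hG : ∀ i j, AnalyticAt ℝ (fun y => G y i j) x) : AnalyticAt ℝ (fun y => (G y).det) x := by
  simp only [Matrix.det_apply']
  exact Finset.analyticAt_fun_sum _ fun σ _ => analyticAt_const.mul
    (Finset.analyticAt_fun_prod _ fun i _ => hG _ _)

/-- The conjugate transpose is only real-linear, which is why analyticity is taken over `ℝ`. -/
theorem analyticAt_conj_apply (X : Matrix (Fin d) (Fin d) ℂ) (i j : Fin d)
    (V : Matrix (Fin d) (Fin d) ℂ) :
    AnalyticAt ℝ (fun V : Matrix (Fin d) (Fin d) ℂ => (Vᴴ * X * V) i j) V :=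
  ((analyticAt_id.matrix_conjTranspose.mul analyticAt_const).mul analyticAt_id).matrix_apply i j

/-- In some orthonormal basis, the matrices of `L` have all vectors as diagonals and no
off-diagonal entry that vanishes on `L`. -/
theorem exists_unitary_diagIn_eq_top_and_offDiag {L : Submodule ℂ (Matrix (Fin d) (Fin d) ℂ)}
    (h1 : 1 ∈ L) (hL : d ≤ Module.finrank ℂ L) :
    ∃ V ∈ Matrix.unitaryGroup (Fin d) ℂ, L.map (diagIn V) = ⊤ ∧
      ∀ i j, i ≠ j → ∃ X ∈ L, (Vᴴ * X * V) i j ≠ 0 := by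
  have : ProperSpace (selfAdjoint (Matrix (Fin d) (Fin d) ℂ)) := FiniteDimensional.proper ℝ _
  let ν : Measure (selfAdjoint (Matrix (Fin d) (Fin d) ℂ)) := Measure.addHaar
  obtain ⟨V₀, hV₀, htop⟩ := exists_map_diagIn_eq_top h1 (by simpa using hL)
  -- With the `Y k` fixed, full diagonals are certified by a determinant, equal to `1` at `V₀` and
  -- hence generically nonzero.
  have hY : ∀ k : Fin d, ∃ Y ∈ L, diagIn V₀ Y = Pi.single k 1 := fun k => by
    have : (Pi.single k 1 : Fin d → ℂ) ∈ L.map (diagIn V₀) := htop ▸ Submodule.mem_top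
    simpa using this
  choose Y hYL hY using hY
  have hdiag : ∀ᵐ H ∂ν, (Matrix.of fun k => diagIn (selfAdjoint.expUnitary H *
      (1 : Matrix.unitaryGroup (Fin d) ℂ) : Matrix.unitaryGroup (Fin d) ℂ) (Y k)).det ≠ 0 := by
    refine ae_ne_zero_expUnitary (U₀ := ⟨V₀, hV₀⟩)
      (F := fun V => (Matrix.of fun k => diagIn V (Y k)).det) ?_ ?_ ν 1
    · intro V _
      exact AnalyticAt.matrix_det fun i j => analyticAt_conj_apply (Y i) j j V
    · have : (Matrix.of fun k => diagIn V₀ (Y k)) = 1 := by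
        ext a b
        simp [hY, Matrix.one_apply, Pi.single_apply, eq_comm]
      simp [this]
  have hoff : ∀ᵐ H ∂ν, ∀ i j, i ≠ j → ∃ X ∈ L, (((selfAdjoint.expUnitary H *
      (1 : Matrix.unitaryGroup (Fin d) ℂ) : Matrix.unitaryGroup (Fin d) ℂ) :
      Matrix (Fin d) (Fin d) ℂ)ᴴ * X * (selfAdjoint.expUnitary H *
      (1 : Matrix.unitaryGroup (Fin d) ℂ) : Matrix.unitaryGroup (Fin d) ℂ)) i j ≠ 0 := by
    rw [ae_all_iff]
    intro i
    rw [ae_all_iff]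
    intro j
    by_cases hij : i = j
    · simp [hij]
    -- An off-diagonal position forces `d ≥ 2`, so `L` is too large to consist of scalar matrices.
    have hd : 1 < d := by
      have := i.2
      have := j.2
      have : i.1 ≠ j.1 := fun h => hij (Fin.ext h)
      omega
    obtain ⟨X, hXL, hX⟩ : ∃ X ∈ L, X ∉ ℂ ∙ (1 : Matrix (Fin d) (Fin d) ℂ) := by
      by_contra! hcon
      have h2 := Submodule.finrank_mono (show L ≤ ℂ ∙ (1 : Matrix (Fin d) (Fin d) ℂ) from hcon)
      have h3 := finrank_span_le_card (R := ℂ) ({1} : Set (Matrix (Fin d) (Fin d) ℂ))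
      simp only [Set.toFinset_singleton, Finset.card_singleton] at h3
      omega
    obtain ⟨V₁, hV₁, hne⟩ := exists_conj_apply_ne_zero hX hij
    have := ae_ne_zero_expUnitary (U₀ := ⟨V₁, hV₁⟩) (F := fun V => (Vᴴ * X * V) i j)
      (fun V _ => analyticAt_conj_apply X i j V) hne ν 1
    filter_upwards [this] with H hH _
    exact ⟨X, hXL, hH⟩
  obtain ⟨H, hH1, hH2⟩ := (hdiag.and hoff).exists
  refine ⟨_, (selfAdjoint.expUnitary H * (1 : Matrix.unitaryGroup (Fin d) ℂ)).2, ?_, hH2⟩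
  have hli := Matrix.linearIndependent_rows_of_det_ne_zero hH1
  rw [eq_top_iff, ← hli.span_eq_top_of_card_eq_finrank' (by simp), Submodule.span_le]
  rintro _ ⟨k, rfl⟩
  exact Submodule.mem_map_of_mem (hYL k)

end Analytic

/-! ### Eigenvalues with distinct quotients and spectral projections -/

section Spectral

theorem le_of_two_pow_add_two_pow_eq {a b c e : ℕ} (hcb : c ≤ b)
    (h : 2 ^ a + 2 ^ e = 2 ^ b + 2 ^ c) : a ≤ b := by
  by_contra! hlt
  have h1 : 2 ^ (b + 1) ≤ 2 ^ a := Nat.pow_le_pow_right two_pos hlt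
  have h2 : 2 ^ c ≤ 2 ^ b := Nat.pow_le_pow_right two_pos hcb
  have h3 := Nat.one_le_two_pow (n := e)
  rw [pow_succ] at h1
  omega

theorem two_pow_add_two_pow_eq {a b c e : ℕ} (h : 2 ^ a + 2 ^ e = 2 ^ b + 2 ^ c) :
    (a = b ∧ e = c) ∨ (a = c ∧ e = b) := by
  wlog hea : e ≤ a generalizing a e
  · have := this (by omega) (le_of_not_ge hea)
    omega
  wlog hcb : c ≤ b generalizing b c
  · have := this (by omega) (le_of_not_ge hcb)
    omega
  have hab := le_antisymm (le_of_two_pow_add_two_pow_eq hcb h)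
    (le_of_two_pow_add_two_pow_eq hea h.symm)
  subst hab
  exact Or.inl ⟨rfl, Nat.pow_right_injective le_rfl (by simpa using h)⟩

/-- Phases on the unit circle, all of whose quotients are distinct. -/
noncomputable def sidonPhase (k : ℕ) : ℂ := Complex.exp ((2 ^ k : ℕ) * Complex.I)

theorem star_sidonPhase (k : ℕ) :
    star (sidonPhase k) = Complex.exp (-((2 ^ k : ℕ) * Complex.I)) := by
  rw [sidonPhase, Complex.star_def, ← Complex.exp_conj, map_mul, Complex.conj_natCast,
    Complex.conj_I, mul_neg]

theorem sidonPhase_mul_star (a b : ℕ) : sidonPhase a * star (sidonPhase b) =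
    Complex.exp ((((2 ^ a : ℕ) - (2 ^ b : ℕ) : ℤ) : ℂ) * Complex.I) := by
  rw [star_sidonPhase, sidonPhase, ← Complex.exp_add]
  congr 1
  push_cast
  ring

theorem sidonPhase_mul_star_self (a : ℕ) : sidonPhase a * star (sidonPhase a) = 1 := by
  rw [sidonPhase_mul_star]
  simp

/-- A coincidence would make a nonzero integer multiple of `2π` an integer, against the
irrationality of `π`. -/
theorem exp_intCast_mul_I_injective :
    Function.Injective fun m : ℤ => Complex.exp ((m : ℂ) * Complex.I) := by
  intro m m' h
  obtain ⟨k, hk⟩ := Complex.exp_eq_exp_iff_exists_int.1 h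
  have h1 : ((m : ℝ) - m') = (2 * k : ℤ) * Real.pi := by
    have h2 : ((m : ℂ) - m') * Complex.I = ((2 * k : ℤ) * (Real.pi : ℂ)) * Complex.I := by
      push_cast
      linear_combination hk
    exact_mod_cast mul_right_cancel₀ Complex.I_ne_zero h2
  by_cases hk0 : k = 0
  · subst hk0
    have h3 : (m : ℝ) = m' := by
      simp at h1
      linarith
    exact_mod_cast h3
  · exfalso
    have hirr : Irrational (((2 * k : ℤ) : ℝ) * Real.pi) :=
      irrational_pi.intCast_mul (by simpa using hk0)
    rw [← h1] at hirr
    exact hirr ⟨((m - m' : ℤ) : ℚ), by push_cast; rfl⟩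

theorem sidonPhase_mul_star_inj {a b c e : ℕ} (hab : a ≠ b)
    (h : sidonPhase a * star (sidonPhase b) = sidonPhase c * star (sidonPhase e)) :
    a = c ∧ b = e := by
  rw [sidonPhase_mul_star, sidonPhase_mul_star] at h
  have h1 := exp_intCast_mul_I_injective h
  have h2 : 2 ^ a + 2 ^ e = 2 ^ b + 2 ^ c := by
    have : (((2 ^ a + 2 ^ e : ℕ)) : ℤ) = ((2 ^ b + 2 ^ c : ℕ) : ℤ) := by
      push_cast at h1 ⊢
      linarith
    exact_mod_cast this
  rcases two_pow_add_two_pow_eq h2 with ⟨h3, _⟩ | ⟨h3, h4⟩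
  · exact absurd h3 hab
  · exact ⟨h3, h4.symm⟩

open Polynomial in
theorem aeval_apply_mem_of_invariant {M : Type*} [AddCommGroup M] [Module ℂ M]
    {T : Module.End ℂ M} {N : Submodule ℂ M} (hT : ∀ Y ∈ N, T Y ∈ N) (p : ℂ[X]) {Y : M}
    (hY : Y ∈ N) : aeval T p Y ∈ N := by
  induction p using Polynomial.induction_on' with
  | add p q hp hq =>
    rw [map_add]
    exact add_mem hp hq
  | monomial k c =>
    rw [aeval_monomial, ← Algebra.smul_def, LinearMap.smul_apply]
    refine N.smul_mem _ ?_
    induction k with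
    | zero => simpa
    | succ k ih =>
      rw [pow_succ', Module.End.mul_apply]
      exact hT _ ih

open Polynomial in
theorem aeval_apply_eq_eval_mul {M : Type*} [AddCommGroup M] [Module ℂ M]
    {T : Module.End ℂ M} {φ : M →ₗ[ℂ] ℂ} {c : ℂ} (hφ : ∀ Y, φ (T Y) = c * φ Y) (p : ℂ[X]) (Y : M) :
    φ (aeval T p Y) = p.eval c * φ Y := by
  induction p using Polynomial.induction_on' with
  | add p q hp hq => simp [hp, hq, add_mul]
  | monomial k a =>
    rw [aeval_monomial, ← Algebra.smul_def, LinearMap.smul_apply, map_smul, eval_monomial,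
      smul_eq_mul, mul_assoc]
    congr 1
    induction k with
    | zero => simp
    | succ k ih => rw [pow_succ', Module.End.mul_apply, hφ, ih, pow_succ', mul_assoc]

variable {d : ℕ}

/-- The unitary with the eigenbasis `V` and the phases `sidonPhase` as eigenvalues. -/
noncomputable def sidonUnitary (V : Matrix (Fin d) (Fin d) ℂ) : Matrix (Fin d) (Fin d) ℂ :=
  V * Matrix.diagonal (fun k : Fin d => sidonPhase k) * Vᴴ

theorem sidonUnitary_mem_unitaryGroup {V : Matrix (Fin d) (Fin d) ℂ}
    (hV : V ∈ Matrix.unitaryGroup (Fin d) ℂ) : sidonUnitary V ∈ Matrix.unitaryGroup (Fin d) ℂ := by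
  refine mul_mem (mul_mem hV ?_) (Unitary.star_mem hV)
  rw [Matrix.mem_unitaryGroup_iff, Matrix.star_eq_conjTranspose, Matrix.diagonal_conjTranspose,
    Matrix.diagonal_mul_diagonal, ← Matrix.diagonal_one]
  congr 1
  ext k
  exact sidonPhase_mul_star_self k

theorem conj_conjBy_sidonUnitary_apply {V : Matrix (Fin d) (Fin d) ℂ}
    (hV : V ∈ Matrix.unitaryGroup (Fin d) ℂ) (Y : Matrix (Fin d) (Fin d) ℂ) (i j : Fin d) :
    (Vᴴ * conjBy (sidonUnitary V) Y * V) i j =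
      (sidonPhase i * star (sidonPhase j)) * (Vᴴ * Y * V) i j := by
  have hVV : Vᴴ * V = 1 := Matrix.mem_unitaryGroup_iff'.1 hV
  set D := Matrix.diagonal (fun k : Fin d => sidonPhase k)
  have e : Vᴴ * conjBy (sidonUnitary V) Y * V = D * (Vᴴ * Y * V) * Dᴴ := by
    calc Vᴴ * conjBy (sidonUnitary V) Y * V
        = (Vᴴ * V) * D * Vᴴ * Y * V * Dᴴ * (Vᴴ * V) := by
          simp [conjBy, sidonUnitary, D, Matrix.conjTranspose_mul, mul_assoc]
      _ = _ := by simp [hVV, mul_assoc]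
  rw [e, Matrix.diagonal_conjTranspose, Matrix.mul_diagonal, Matrix.diagonal_mul]
  simp only [Pi.star_apply]
  ring

theorem eq_top_of_conjBy_sidonUnitary_mem {V : Matrix (Fin d) (Fin d) ℂ}
    (hV : V ∈ Matrix.unitaryGroup (Fin d) ℂ) {L N : Submodule ℂ (Matrix (Fin d) (Fin d) ℂ)}
    (hdiag : L.map (diagIn V) = ⊤) (hoff : ∀ i j, i ≠ j → ∃ X ∈ L, (Vᴴ * X * V) i j ≠ 0)
    (hLN : L ≤ N) (hN : ∀ Y ∈ N, conjBy (sidonUnitary V) Y ∈ N) : N = ⊤ := by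
  classical
  have hVV : Vᴴ * V = 1 := Matrix.mem_unitaryGroup_iff'.1 hV
  have hVV' : V * Vᴴ = 1 := Matrix.mem_unitaryGroup_iff.1 hV
  have hback : ∀ Y, Y = V * (Vᴴ * Y * V) * Vᴴ := fun Y => by
    calc Y = (V * Vᴴ) * Y * (V * Vᴴ) := by simp [hVV']
      _ = _ := by simp only [mul_assoc]
  set c : Fin d × Fin d → ℂ := fun q => sidonPhase q.1 * star (sidonPhase q.2) with hc
  set S : Finset ℂ := Finset.univ.image c with hS
  have hproj : ∀ (q : Fin d × Fin d) (X : Matrix (Fin d) (Fin d) ℂ), X ∈ L →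
      V * (Matrix.of fun i j => if c (i, j) = c q then (Vᴴ * X * V) i j else 0) * Vᴴ ∈ N := by
    intro q X hX
    -- This polynomial is `1` at the eigenvalue `c q` and `0` at the others, so evaluated at the
    -- conjugation it is the spectral projection.
    set p := Lagrange.basis S id (c q)
    have hmem := aeval_apply_mem_of_invariant (T := conjBy (sidonUnitary V)) hN p (hLN hX)
    rw [hback (Polynomial.aeval (R := ℂ) (A := Module.End ℂ (Matrix (Fin d) (Fin d) ℂ))
      (conjBy (sidonUnitary V)) p X)] at hmem
    convert hmem using 3
    ext i j
    let φ : Matrix (Fin d) (Fin d) ℂ →ₗ[ℂ] ℂ :=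
      { toFun := fun Y => (Vᴴ * Y * V) i j
        map_add' := fun Y Z => by simp [mul_add, add_mul]
        map_smul' := fun a Y => by simp }
    have h := aeval_apply_eq_eval_mul (T := conjBy (sidonUnitary V)) (φ := φ) (c := c (i, j))
      (fun Y => conj_conjBy_sidonUnitary_apply hV Y i j) p X
    refine Eq.trans ?_ h.symm
    have hij : c (i, j) ∈ S := Finset.mem_image_of_mem _ (Finset.mem_univ _)
    have hq : c q ∈ S := Finset.mem_image_of_mem _ (Finset.mem_univ _)
    rw [Matrix.of_apply]
    split_ifs with heq
    · have : p.eval (c (i, j)) = 1 := by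
        rw [heq]
        exact Lagrange.eval_basis_self (v := id) Function.injective_id.injOn hq
      rw [this, one_mul]
      rfl
    · have : p.eval (c (i, j)) = 0 :=
        Lagrange.eval_basis_of_ne (v := id) (fun h => heq h.symm) hij
      rw [this, zero_mul]
  have hsingle : ∀ i j : Fin d, V * Matrix.single i j 1 * Vᴴ ∈ N := by
    intro i j
    by_cases hij : i = j
    · subst hij
      obtain ⟨X, hX, hXi⟩ : (Pi.single i 1 : Fin d → ℂ) ∈ L.map (diagIn V) :=
        hdiag ▸ Submodule.mem_top
      -- The eigenvalue `1` occurs at all diagonal positions and no others, so the projection keeps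
      -- the whole diagonal of `X`, chosen to be a basis vector.
      refine (congrArg (fun M => V * M * Vᴴ ∈ N) ?_).mpr (hproj (i, i) X hX)
      ext a b
      have hci : c (i, i) = 1 := sidonPhase_mul_star_self i
      rw [Matrix.of_apply, hci]
      by_cases hab : a = b
      · subst hab
        rw [if_pos (sidonPhase_mul_star_self a), ← diagIn_apply, hXi]
        simp [Matrix.single_apply, Pi.single_apply, eq_comm]
      · rw [if_neg]
        · simp only [Matrix.single_apply]
          rw [if_neg]
          rintro ⟨rfl, rfl⟩
          exact hab rfl
        · intro h
          rw [← hci] at h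
          have := sidonPhase_mul_star_inj (fun h => hab (Fin.ext h)) h
          exact hab (Fin.ext (this.1.trans this.2.symm))
    · obtain ⟨X, hX, hne⟩ := hoff i j hij
      refine (N.smul_mem_iff hne).1 ?_
      rw [← Matrix.smul_mul, ← Matrix.mul_smul]
      refine (congrArg (fun M => V * M * Vᴴ ∈ N) ?_).mpr (hproj (i, j) X hX)
      ext a b
      rw [Matrix.of_apply]
      split_ifs with h
      · have := sidonPhase_mul_star_inj (fun h => hij (Fin.ext h)) h.symm
        obtain rfl : i = a := Fin.ext this.1
        obtain rfl : j = b := Fin.ext this.2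
        simp
      · rw [Matrix.smul_apply, Matrix.single_apply, if_neg]
        · simp
        · rintro ⟨rfl, rfl⟩
          exact h rfl
  rw [eq_top_iff]
  intro Y _
  rw [hback Y, Matrix.matrix_eq_sum_single (Vᴴ * Y * V)]
  simp only [Finset.mul_sum, Finset.sum_mul]
  refine sum_mem fun i _ => sum_mem fun j _ => ?_
  have := N.smul_mem ((Vᴴ * Y * V) i j) (hsingle i j)
  rwa [← Matrix.smul_mul, ← Matrix.mul_smul, Matrix.smul_single, smul_eq_mul, mul_one] at this

end Spectral

/-! ### Observability, tomography and sampling -/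

section Observability
variable {d : ℕ}

/-- Finitely many evolved observables already span, and the traces against a spanning set determine
a matrix. The expectation map is therefore injective on all matrices, and any left inverse
reconstructs. -/
theorem MarkovEvolution.IsObservable.dqstFeasible {T : Type} [AddMonoid T]
    {E : MarkovEvolution T d} {𝒳 : Observables d} (h : E.IsObservable 𝒳) :
    E.DQSTFeasible 𝒳 := by
  classical
  have hfg : (Submodule.span ℂ {Y | ∃ t : T, ∃ X ∈ 𝒳.carrier, Y = E.Φ t X}).FG :=
    IsNoetherian.noetherian _
  obtain ⟨s, hs, hspan⟩ := Submodule.fg_span_iff_fg_span_finset_subset _ |>.1 hfg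
  have hs' : ∀ Y : s, ∃ r : 𝒳.carrier × T, (Y : Matrix (Fin d) (Fin d) ℂ) = E.Φ r.2 r.1 := by
    rintro ⟨Y, hY⟩
    obtain ⟨t, X, hX, e⟩ := hs hY
    exact ⟨(⟨X, hX⟩, t), e⟩
  choose r hr using hs'
  let R : Finset (𝒳.carrier × T) := Finset.univ.image r
  let g : Matrix (Fin d) (Fin d) ℂ → R → ℂ := fun ρ r =>
    expectation ρ (E.Φ r.1.2 (r.1.1 : Matrix (Fin d) (Fin d) ℂ))
  have hg : Function.Injective g := by
    intro ρ ρ' he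
    refine Matrix.ext_iff_trace_mul_left.2 fun Y => ?_
    have hY : Y ∈ Submodule.span ℂ (s : Set (Matrix (Fin d) (Fin d) ℂ)) := by
      rw [← hspan]
      exact (show Submodule.span ℂ _ = ⊤ from h) ▸ Submodule.mem_top
    induction hY using Submodule.span_induction with
    | mem Y hY =>
      have := congrFun he ⟨r ⟨Y, hY⟩, Finset.mem_image_of_mem _ (Finset.mem_univ _)⟩
      simpa only [g, ← hr, expectation] using this
    | zero => simp
    | add Y Z _ _ h1 h2 => simp [add_mul, h1, h2]
    | smul c Y _ h1 => simp [h1]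
  exact ⟨R, Function.invFun g, fun ρ _ => Function.leftInverse_invFun hg ρ⟩

theorem conjBy_mem_observableSubspace (U : Matrix.unitaryGroup (Fin d) ℂ) (𝒳 : Observables d)
    {Y : Matrix (Fin d) (Fin d) ℂ} (hY : Y ∈ (discreteUnitary U).observableSubspace 𝒳) :
    conjBy (U : Matrix (Fin d) (Fin d) ℂ) Y ∈ (discreteUnitary U).observableSubspace 𝒳 := by
  suffices h : (discreteUnitary U).observableSubspace 𝒳 ≤
      ((discreteUnitary U).observableSubspace 𝒳).comap
        (conjBy (U : Matrix (Fin d) (Fin d) ℂ)) from h hY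
  refine Submodule.span_le.2 ?_
  rintro _ ⟨t, X, hX, rfl⟩
  refine Submodule.subset_span ⟨t + 1, X, hX, ?_⟩
  change conjBy _ (conjBy _ X) = conjBy ((U : Matrix (Fin d) (Fin d) ℂ) ^ (t + 1)) X
  rw [pow_succ']
  simp only [conjBy, LinearMap.coe_mk, AddHom.coe_mk, Matrix.conjTranspose_mul, mul_assoc]

theorem exists_discreteUnitary_isObservable (𝒳 : Observables d) (hcard : d ≤ 𝒳.carrier.card) :
    ∃ U, (discreteUnitary U).IsObservable 𝒳 := by
  have hfr : Module.finrank ℂ (Submodule.span ℂ (𝒳.carrier : Set (Matrix (Fin d) (Fin d) ℂ))) =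
      𝒳.carrier.card := finrank_span_finset_eq_card 𝒳.linearIndependent
  obtain ⟨V, hV, hdiag, hoff⟩ := exists_unitary_diagIn_eq_top_and_offDiag
    (Submodule.subset_span 𝒳.one_mem) (hcard.trans hfr.ge)
  refine ⟨⟨sidonUnitary V, sidonUnitary_mem_unitaryGroup hV⟩,
    eq_top_of_conjBy_sidonUnitary_mem hV hdiag hoff ?_
      fun Y hY => conjBy_mem_observableSubspace _ 𝒳 hY⟩
  refine Submodule.span_mono fun X hX => ⟨0, X, hX, ?_⟩
  rw [MarkovEvolution.map_zero, LinearMap.id_apply]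

/-- The determinant of the matrix entries of `U^t X (U^t)†` for `d²` pairs `(X, t)`. -/
noncomputable def orbitDet (X : Fin d × Fin d → Matrix (Fin d) (Fin d) ℂ) (t : Fin d × Fin d → ℕ)
    (U : Matrix (Fin d) (Fin d) ℂ) : ℂ :=
  (Matrix.of fun p q : Fin d × Fin d => conjBy (U ^ t p) (X p) q.1 q.2).det

open scoped Matrix.Norms.L2Operator in
theorem analyticOnNhd_orbitDet (X : Fin d × Fin d → Matrix (Fin d) (Fin d) ℂ)
    (t : Fin d × Fin d → ℕ) : AnalyticOnNhd ℝ (orbitDet X t) Set.univ := fun _ _ =>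
  AnalyticAt.matrix_det fun p q => AnalyticAt.matrix_apply
    (((analyticAt_id.pow (t p)).mul analyticAt_const).mul
      (analyticAt_id.pow (t p)).matrix_conjTranspose) q.1 q.2

/-- The linear equivalence of matrices with functions of pairs of indices. -/
def matrixEquivFun (d : ℕ) : Matrix (Fin d) (Fin d) ℂ ≃ₗ[ℂ] (Fin d × Fin d → ℂ) :=
  (Matrix.ofLinearEquiv ℂ).symm ≪≫ₗ (LinearEquiv.curry ℂ ℂ (Fin d) (Fin d)).symm

theorem orbitDet_ne_zero_iff (X : Fin d × Fin d → Matrix (Fin d) (Fin d) ℂ)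
    (t : Fin d × Fin d → ℕ) (U : Matrix (Fin d) (Fin d) ℂ) :
    orbitDet X t U ≠ 0 ↔ LinearIndependent ℂ fun p => conjBy (U ^ t p) (X p) := by
  rw [orbitDet, ← isUnit_iff_ne_zero, ← Matrix.isUnit_iff_isUnit_det,
    ← Matrix.linearIndependent_rows_iff_isUnit,
    ← (matrixEquivFun d).toLinearMap.linearIndependent_iff (LinearEquiv.ker _)]
  rfl

/-- A basis extracted from the orbit of one observable unitary fixes the pairs, so that genericity
concerns a single analytic function. -/
theorem exists_orbitDet (𝒳 : Observables d) (hcard : d ≤ 𝒳.carrier.card) :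
    ∃ (X : Fin d × Fin d → Matrix (Fin d) (Fin d) ℂ) (t : Fin d × Fin d → ℕ),
      (∀ p, X p ∈ 𝒳.carrier) ∧ ∃ U : Matrix.unitaryGroup (Fin d) ℂ, orbitDet X t U ≠ 0 := by
  obtain ⟨U, hU⟩ := exists_discreteUnitary_isObservable 𝒳 hcard
  obtain ⟨b, hb, hspan, hli⟩ := exists_linearIndependent ℂ
    {Y | ∃ t : ℕ, ∃ X ∈ 𝒳.carrier, Y = (discreteUnitary U).Φ t X}
  have htop : ⊤ ≤ Submodule.span ℂ (Set.range ((↑) : b → Matrix (Fin d) (Fin d) ℂ)) := by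
    rw [Subtype.range_coe, hspan]
    exact hU.ge
  let B := Module.Basis.mk hli htop
  let e := (Matrix.stdBasis ℂ (Fin d) (Fin d)).indexEquiv B
  choose t X hX hY using fun p : Fin d × Fin d => hb (e p).2
  refine ⟨X, t, hX, U, (orbitDet_ne_zero_iff X t U).2 ?_⟩
  have hli' := hli.comp e e.injective
  rwa [show Subtype.val ∘ e = fun p => conjBy ((U : Matrix (Fin d) (Fin d) ℂ) ^ t p) (X p) from
    funext hY] at hli'

theorem isObservable_of_orbitDet_ne_zero {𝒳 : Observables d}
    {X : Fin d × Fin d → Matrix (Fin d) (Fin d) ℂ} {t : Fin d × Fin d → ℕ}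
    (hX : ∀ p, X p ∈ 𝒳.carrier) {U : Matrix.unitaryGroup (Fin d) ℂ} (h : orbitDet X t U ≠ 0) :
    (discreteUnitary U).IsObservable 𝒳 := by
  have hli := (orbitDet_ne_zero_iff X t U).1 h
  have htop := hli.span_eq_top_of_card_eq_finrank'
    (by simp [Module.finrank_matrix])
  refine top_le_iff.1 (htop.ge.trans (Submodule.span_mono ?_))
  rintro _ ⟨p, rfl⟩
  exact ⟨t p, X p, hX p, rfl⟩

theorem propagator_natCast_mul (H : Matrix (Fin d) (Fin d) ℂ) (τ : ℝ) (t : ℕ) :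
    propagator H (t * τ) = propagator H τ ^ t := by
  induction t with
  | zero => simp [propagator_zero]
  | succ t ih => rw [Nat.cast_succ, add_mul, one_mul, propagator_add, ih, pow_succ]

/-- Sampling the flow at the multiples of `τ` recovers the discrete evolution, whose orbit already
spans. -/
theorem isObservable_hamiltonianEvolution {𝒳 : Observables d}
    {U : Matrix.unitaryGroup (Fin d) ℂ} (hU : (discreteUnitary U).IsObservable 𝒳)
    {H : selfAdjoint (Matrix (Fin d) (Fin d) ℂ)} {τ : ℝ} (hτ : 0 ≤ τ)
    (h : propagator (H : Matrix (Fin d) (Fin d) ℂ) τ = (U : Matrix (Fin d) (Fin d) ℂ)) :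
    (hamiltonianEvolution H).IsObservable 𝒳 := by
  refine top_le_iff.1 (hU.ge.trans (Submodule.span_mono ?_))
  rintro _ ⟨t, X, hX, rfl⟩
  refine ⟨t * ⟨τ, hτ⟩, X, hX, ?_⟩
  change conjBy _ X = conjBy (propagator _ (t * τ)) X
  rw [propagator_natCast_mul, h]

end Observability

theorem mainTheorem7 (d : ℕ) (𝒳 : Observables d) (hcard : d ≤ 𝒳.carrier.card)
    (μ : Measure (Matrix.unitaryGroup (Fin d) ℂ)) [μ.IsHaarMeasure]
    (ν : Measure (selfAdjoint (Matrix (Fin d) (Fin d) ℂ))) [ν.IsAddHaarMeasure] :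
    (∀ᵐ U ∂μ, (discreteUnitary U).IsObservable 𝒳 ∧ (discreteUnitary U).DQSTFeasible 𝒳) ∧
    (∀ᵐ (U : Matrix.unitaryGroup (Fin d) ℂ) ∂μ, ∀ (H : selfAdjoint (Matrix (Fin d) (Fin d) ℂ)) (τ : ℝ), 0 < τ →
      propagator (H : Matrix (Fin d) (Fin d) ℂ) τ = (U : Matrix (Fin d) (Fin d) ℂ) →
      (hamiltonianEvolution H).IsObservable 𝒳 ∧ (hamiltonianEvolution H).DQSTFeasible 𝒳) ∧
    (∀ᵐ H ∂ν,
      (hamiltonianEvolution H).IsObservable 𝒳 ∧ (hamiltonianEvolution H).DQSTFeasible 𝒳) := by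
  obtain ⟨X, t, hX, U₀, hU₀⟩ := exists_orbitDet 𝒳 hcard
  have hF := analyticOnNhd_orbitDet X t
  have hμ := ae_ne_zero_unitaryGroup hF hU₀ μ ν
  -- No translation is needed here: `exp (iH)` itself is the propagator at time `1`.
  have hν := ae_ne_zero_expUnitary hF hU₀ ν 1
  refine ⟨?_, ?_, ?_⟩
  · filter_upwards [hμ] with U hU
    have h := isObservable_of_orbitDet_ne_zero hX hU
    exact ⟨h, h.dqstFeasible⟩
  · filter_upwards [hμ] with U hU H τ hτ hH
    have h := isObservable_hamiltonianEvolution (isObservable_of_orbitDet_ne_zero hX hU) hτ.le hH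
    exact ⟨h, h.dqstFeasible⟩
  · filter_upwards [hν] with H hH
    have h := isObservable_hamiltonianEvolution (isObservable_of_orbitDet_ne_zero hX hH)
      (H := H) zero_le_one (by simp [propagator])
    exact ⟨h, h.dqstFeasible⟩
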